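/- Let $n\ge 4$. A \emph{rectifiable path} in $\mathbb{R}^n$ is a continuous map $\alpha\colon[0,1]\to\mathbb{R}^n$ of finite length, and the \emph{Fréchet distance} of two rectifiable paths is $$d_{FP}(\alpha,\beta)=\inf_{r}\,\max_{t\in[0,1]}\lVert\alpha(t)-\beta(r(t))\rVert_2,$$ where $r$ ranges over all homeomorphisms $[0,1]\to[0,1]$ with $r(0)=0$. Identify two rectifiable paths when their Fréchet distance is $0$, so that $d_{FP}$ is a metric on the set of equivalence classes, and let $\Pi_{\mathcal E}$ be the subspace of those classes $[\alpha]$ that are represented by an embedding $\alpha$ (a homeomorphism onto its image), with the restricted metric $d_{FP}$. Then for every $x\in\Pi_{\mathcal E}$ and every real $\delta>0$ the open ball $\{y\in\Pi_{\mathcal E} : d_{FP}(x,y)<\delta\}$ is path-connected (as a subspace of the metric space $(\Pi_{\mathcal E},d_{FP})$). -/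

import Mathlib

open Set Metric Topology
open scoped unitInterval

/-- A rectifiable path in `ℝⁿ` (with the Euclidean norm): a continuous map `[0,1] → ℝⁿ` whose
length, the supremum of `∑ ‖γ(tᵢ₊₁) - γ(tᵢ)‖` over finite partitions of `[0,1]`, is finite. -/
structure RectifiablePath (n : ℕ) where
  toMap : C(I, EuclideanSpace ℝ (Fin n))
  length_ne_top : eVariationOn toMap Set.univ ≠ ⊤

namespace RectifiablePath

/-- The homeomorphisms `r : [0,1] → [0,1]` with `r(0) = 0`. -/
abbrev Reparam : Type := {r : I ≃ₜ I // r 0 = 0}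

/-- The path Fréchet distance: the infimum over `r` of the maximum over `t` of
`‖α(t) - β(r(t))‖`. -/
noncomputable def frechetDist {n : ℕ} (α β : RectifiablePath n) : ℝ :=
  ⨅ r : Reparam, ⨆ t : I, ‖α.toMap t - β.toMap (r.1 t)‖

theorem frechetDist_eq {n : ℕ} (α β : RectifiablePath n) :
    frechetDist α β =
      ⨅ r : Reparam, dist α.toMap (β.toMap.comp (r.1 : C(I, I))) := by
  unfold frechetDist
  congr 1
  funext r
  rw [ContinuousMap.dist_eq_iSup]
  simp [dist_eq_norm]

theorem bddBelow_dist {n : ℕ} (α β : RectifiablePath n) :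
    BddBelow (Set.range fun r : Reparam => dist α.toMap (β.toMap.comp (r.1 : C(I, I)))) :=
  ⟨0, by rintro _ ⟨r, rfl⟩; exact dist_nonneg⟩

instance : Nonempty Reparam := ⟨⟨Homeomorph.refl I, rfl⟩⟩

theorem frechetDist_le {n : ℕ} (α β : RectifiablePath n) (r : Reparam) :
    frechetDist α β ≤ dist α.toMap (β.toMap.comp (r.1 : C(I, I))) := by
  rw [frechetDist_eq]
  exact ciInf_le (bddBelow_dist α β) r

theorem dist_comp_le {n : ℕ} (f g : C(I, EuclideanSpace ℝ (Fin n))) (h : C(I, I)) :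
    dist (f.comp h) (g.comp h) ≤ dist f g :=
  (ContinuousMap.dist_le dist_nonneg).2 fun t => ContinuousMap.dist_apply_le_dist (h t)

theorem frechetDist_self {n : ℕ} (α : RectifiablePath n) : frechetDist α α = 0 := by
  apply le_antisymm
  · have h := frechetDist_le α α ⟨Homeomorph.refl I, rfl⟩
    have e : α.toMap.comp ((Homeomorph.refl I : I ≃ₜ I) : C(I, I)) = α.toMap := by
      ext t; rfl
    simpa [e] using h
  · rw [frechetDist_eq]
    exact le_ciInf fun r => dist_nonneg

theorem frechetDist_le_swap {n : ℕ} (α β : RectifiablePath n) :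
    frechetDist α β ≤ frechetDist β α := by
  rw [frechetDist_eq β α]
  refine le_ciInf fun r => ?_
  have hr : r.1.symm 0 = 0 := by rw [Homeomorph.symm_apply_eq]; exact r.2.symm
  refine (frechetDist_le α β ⟨r.1.symm, hr⟩).trans ?_
  have h := dist_comp_le (α.toMap.comp (r.1 : C(I, I))) β.toMap (r.1.symm : C(I, I))
  have e : (α.toMap.comp (r.1 : C(I, I))).comp (r.1.symm : C(I, I)) = α.toMap := by
    ext t; simp
  rw [e] at h
  exact h.trans_eq (dist_comm _ _)

theorem frechetDist_triangle {n : ℕ} (α β γ : RectifiablePath n) :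
    frechetDist α γ ≤ frechetDist α β + frechetDist β γ := by
  rw [frechetDist_eq α β, frechetDist_eq β γ]
  refine le_ciInf_add_ciInf fun r s => ?_
  refine (frechetDist_le α γ ⟨r.1.trans s.1, by simp [r.2, s.2]⟩).trans ?_
  refine (dist_triangle _ (β.toMap.comp (r.1 : C(I, I))) _).trans ?_
  gcongr
  exact dist_comp_le β.toMap (γ.toMap.comp (s.1 : C(I, I))) (r.1 : C(I, I))

noncomputable instance (n : ℕ) : PseudoMetricSpace (RectifiablePath n) where
  dist := frechetDist
  dist_self := frechetDist_self
  dist_comm α β := le_antisymm (frechetDist_le_swap α β) (frechetDist_le_swap β α)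
  dist_triangle := frechetDist_triangle

end RectifiablePath

/-- The metric space of all rectifiable paths in `ℝⁿ`, two paths being identified when their
Fréchet distance is zero, with the metric induced by the Fréchet distance. -/
abbrev PathSpace (n : ℕ) : Type := SeparationQuotient (RectifiablePath n)

/-- The subspace of the classes that are represented by an embedding `[0,1] → ℝⁿ`, with the
restricted metric. -/
abbrev EmbeddedPathSpace (n : ℕ) : Type :=
  {p : PathSpace n // ∃ α : RectifiablePath n, IsEmbedding α.toMap ∧ SeparationQuotient.mk α = p}

/-! Reparametrizing one path does not change its class, so two embedded paths at Fréchet distance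
below `δ` may be taken at uniform distance below `δ`. The straight-line homotopy between them may
pass through non-injective curves, so it is bent by `s (1 - s) t v`. A collision at time `s` of
parameters `t < u` can be solved for `v`: the bad `v` are the values of a `C¹` map on triples of a
time and two points of a curve of bounded variation. Such triples have Hausdorff dimension at most 3
< `n`, so the good `v` are dense, and a small one keeps the homotopy in the ball
(`dense_injective_bent_homotopy`, `exists_bentHomotopy_injective`). -/

/-! ### Bounded variation and Hausdorff dimension -/

theorem eVariationOn_prodMk_le {α E F : Type*} [LinearOrder α] [PseudoEMetricSpace E]
    [PseudoEMetricSpace F] (f : α → E) (g : α → F) (s : Set α) :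
    eVariationOn (fun x => (f x, g x)) s ≤ eVariationOn f s + eVariationOn g s := by
  refine iSup_le fun p => ?_
  refine le_trans (Finset.sum_le_sum fun i _ => ?_)
    ((Finset.sum_add_distrib).trans_le (add_le_add
      (eVariationOn.sum_le p.2.2.1 p.2.2.2) (eVariationOn.sum_le p.2.2.1 p.2.2.2)))
  rw [Prod.edist_eq]
  exact max_le le_self_add le_add_self

theorem BoundedVariationOn.prodMk {α E F : Type*} [LinearOrder α] [PseudoEMetricSpace E]
    [PseudoEMetricSpace F] {f : α → E} {g : α → F} {s : Set α} (hf : BoundedVariationOn f s)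
    (hg : BoundedVariationOn g s) : BoundedVariationOn (fun x => (f x, g x)) s :=
  ne_top_of_le_ne_top (ENNReal.add_ne_top.2 ⟨hf, hg⟩) (eVariationOn_prodMk_le f g s)

/-- The range of a function of bounded variation is a Lipschitz image of a set of reals. -/
theorem BoundedVariationOn.exists_lipschitzOnWith {α F : Type*} [LinearOrder α] [Nonempty α]
    [MetricSpace F] {f : α → F} (hf : BoundedVariationOn f univ) :
    ∃ (S : Set ℝ) (g : ℝ → F), LipschitzOnWith 1 g S ∧ range f ⊆ g '' S := by
  obtain ⟨a⟩ := ‹Nonempty α›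
  have hl := hf.locallyBoundedVariationOn
  -- `L` is signed arc length from `a`; `f` is 1-Lipschitz with respect to it, hence factors through
  -- it.
  set L : α → ℝ := variationOnFromTo f univ a with hL
  have key : ∀ x y, edist (f x) (f y) ≤ edist (L x) (L y) := by
    have aux : ∀ x y, x ≤ y → edist (f x) (f y) ≤ edist (L x) (L y) := fun x y hxy => by
      have h1 : L y - L x = variationOnFromTo f univ x y := sub_eq_of_eq_add'
        (variationOnFromTo.add hl (mem_univ a) (mem_univ x) (mem_univ y)).symm
      rw [edist_comm (L x), edist_dist (L y), Real.dist_eq, h1,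
        abs_of_nonneg (variationOnFromTo.nonneg_of_le f univ hxy),
        variationOnFromTo.eq_of_le f univ hxy, ENNReal.ofReal_toReal]
      · exact eVariationOn.edist_le f ⟨mem_univ _, left_mem_Icc.2 hxy⟩
          ⟨mem_univ _, right_mem_Icc.2 hxy⟩
      · exact hl x y (mem_univ _) (mem_univ _)
    intro x y
    rcases le_total x y with h | h
    · exact aux x y h
    · rw [edist_comm, edist_comm (L x)]
      exact aux y x h
  have hinv : ∀ l ∈ range L, L (Function.invFun L l) = l := fun l hl => Function.invFun_eq hl
  refine ⟨range L, fun l => f (Function.invFun L l), ?_, ?_⟩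
  · intro l hl m hm
    refine (key _ _).trans ?_
    rw [hinv l hl, hinv m hm]
    simp
  · rintro _ ⟨x, rfl⟩
    refine ⟨L x, mem_range_self x, edist_le_zero.1 ((key _ _).trans_eq ?_)⟩
    rw [hinv _ (mem_range_self x), edist_self]

/-- Hausdorff dimension is not subadditive on products in general, so the whole product is
parametrized by a subset of `ℝ × ℝ × ℝ` through a Lipschitz map. -/
theorem BoundedVariationOn.dimH_prod_range_le {α F : Type*} [LinearOrder α] [Nonempty α]
    [MetricSpace F] {f : α → F} (hf : BoundedVariationOn f univ) (S : Set ℝ) :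
    dimH (S ×ˢ range f ×ˢ range f) ≤ 3 := by
  obtain ⟨T, g, hg, hT⟩ := hf.exists_lipschitzOnWith
  have hlip : LipschitzOnWith 1 (fun p : ℝ × ℝ × ℝ => (p.1, g p.2.1, g p.2.2)) (S ×ˢ T ×ˢ T) := by
    intro p hp q hq
    simp only [ENNReal.coe_one, one_mul, Prod.edist_eq]
    refine max_le_max le_rfl (max_le_max ?_ ?_)
    · simpa using hg hp.2.1 hq.2.1
    · simpa using hg hp.2.2 hq.2.2
  have hsub : S ×ˢ range f ×ˢ range f ⊆
      (fun p : ℝ × ℝ × ℝ => (p.1, g p.2.1, g p.2.2)) '' (S ×ˢ T ×ˢ T) := by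
    rintro ⟨s, x, y⟩ ⟨hs, hx, hy⟩
    obtain ⟨l, hl, rfl⟩ := hT hx
    obtain ⟨m, hm, rfl⟩ := hT hy
    exact ⟨(s, l, m), ⟨hs, hl, hm⟩, rfl⟩
  calc dimH (S ×ˢ range f ×ˢ range f) ≤ dimH (S ×ˢ T ×ˢ T) :=
        (dimH_mono hsub).trans hlip.dimH_image_le
    _ ≤ dimH (univ : Set (ℝ × ℝ × ℝ)) := dimH_mono (subset_univ _)
    _ = 3 := by
      rw [Real.dimH_univ_eq_finrank]
      norm_num [Module.finrank_prod]

/-! ### General position for the bent homotopy -/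

theorem boundedVariationOn_unitInterval_coe :
    BoundedVariationOn (fun t : I => (t : ℝ)) univ :=
  MonotoneOn.boundedVariationOn (C := 1) (fun _ _ _ _ h => h)
    fun x _ => by rw [abs_of_nonneg x.2.1]; exact x.2.2

theorem boundedVariationOn_bentHomotopy {E : Type*} [NormedAddCommGroup E] [NormedSpace ℝ E]
    {a b : I → E} (ha : BoundedVariationOn a univ) (hb : BoundedVariationOn b univ) (v : E)
    (s : ℝ) : BoundedVariationOn
      (fun t : I => (1 - s) • a t + s • b t + (s * (1 - s)) • (t : ℝ) • v) univ := by
  let K : E × E × ℝ →L[ℝ] E :=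
    (1 - s) • ContinuousLinearMap.fst ℝ E (E × ℝ) +
      s • (ContinuousLinearMap.fst ℝ E ℝ).comp (ContinuousLinearMap.snd ℝ E (E × ℝ)) +
      (s * (1 - s)) • ((ContinuousLinearMap.snd ℝ E ℝ).comp
        (ContinuousLinearMap.snd ℝ E (E × ℝ))).smulRight v
  have hK : (fun t : I => (1 - s) • a t + s • b t + (s * (1 - s)) • (t : ℝ) • v) =
      K ∘ fun t : I => (a t, b t, (t : ℝ)) := by
    funext t
    simp [K]
  rw [hK]
  exact LipschitzWith.comp_boundedVariationOn K.lipschitz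
    (ha.prodMk (hb.prodMk boundedVariationOn_unitInterval_coe))

/-- For two injective paths of bounded variation in dimension at least four, a dense set of
vectors `v` makes all the intermediate curves of the straight-line homotopy, bent by
`s (1 - s) t v`, injective. -/
theorem dense_injective_bent_homotopy {E : Type*} [NormedAddCommGroup E] [NormedSpace ℝ E]
    [FiniteDimensional ℝ E] (hE : 4 ≤ Module.finrank ℝ E) {a b : I → E}
    (ha : BoundedVariationOn a univ) (hb : BoundedVariationOn b univ) :
    Dense {v : E | ∀ s ∈ Ioo (0 : ℝ) 1, Function.Injective
      fun t : I => (1 - s) • a t + s • b t + (s * (1 - s)) • (t : ℝ) • v} := by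
  -- The parameter is recorded as a coordinate because the bend depends on it.
  let c : I → E × E × ℝ := fun t => (a t, b t, (t : ℝ))
  have hc : BoundedVariationOn c univ := ha.prodMk (hb.prodMk boundedVariationOn_unitInterval_coe)
  -- Ordering the parameters, instead of only asking that they differ, makes this domain convex, as
  -- `ContDiffOn.dimH_image_le` needs.
  let U : Set (ℝ × (E × E × ℝ) × (E × E × ℝ)) :=
    {z | 0 < z.1 ∧ z.1 < 1 ∧ z.2.1.2.2 < z.2.2.2.2}
  -- The unique `v` for which the two points collide at time `z.1`.
  let Φ : ℝ × (E × E × ℝ) × (E × E × ℝ) → E := fun z =>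
    -((z.1 * (1 - z.1) * (z.2.2.2.2 - z.2.1.2.2))⁻¹ •
      ((1 - z.1) • (z.2.2.1 - z.2.1.1) + z.1 • (z.2.2.2.1 - z.2.1.2.1)))
  have hU : Convex ℝ U := by
    rintro x ⟨hx0, hx1, hx⟩ y ⟨hy0, hy1, hy⟩ p q hp hq hpq
    simp only [U, mem_ofPred_eq, Prod.fst_add, Prod.smul_fst, Prod.snd_add, Prod.smul_snd,
      smul_eq_mul]
    have hp' : 0 < p ∨ 0 < q := by
      by_contra! h
      linarith
    refine ⟨?_, ?_, ?_⟩ <;> rcases hp' with h | h <;>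
      nlinarith [mul_pos h hx0, mul_pos h hy0, mul_nonneg hp hx0.le, mul_nonneg hq hy0.le,
        mul_pos h (sub_pos.2 hx1), mul_pos h (sub_pos.2 hy1), mul_nonneg hp (sub_pos.2 hx1).le,
        mul_nonneg hq (sub_pos.2 hy1).le, mul_pos h (sub_pos.2 hx), mul_pos h (sub_pos.2 hy),
        mul_nonneg hp (sub_pos.2 hx).le, mul_nonneg hq (sub_pos.2 hy).le]
  have hne : ∀ z ∈ U, z.1 * (1 - z.1) * (z.2.2.2.2 - z.2.1.2.2) ≠ 0 := fun z hz =>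
    (mul_pos (mul_pos hz.1 (sub_pos.2 hz.2.1)) (sub_pos.2 hz.2.2)).ne'
  have hΦ : ContDiffOn ℝ 1 Φ U := by
    refine ContDiffOn.neg (ContDiffOn.smul (ContDiffOn.inv ?_ hne) ?_)
    · fun_prop
    · fun_prop
  let T := (Ioo (0 : ℝ) 1 ×ˢ range c ×ˢ range c) ∩ U
  have hdim : dimH (Φ '' T) < Module.finrank ℝ E := by
    refine (hΦ.dimH_image_le hU inter_subset_right).trans_lt ?_
    refine ((dimH_mono inter_subset_left).trans (hc.dimH_prod_range_le _)).trans_lt ?_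
    exact_mod_cast (by omega : 3 < Module.finrank ℝ E)
  refine (dense_compl_of_dimH_lt_finrank hdim).mono fun v hv s hs => ?_
  have main : ∀ t u : I, t < u →
      (1 - s) • a t + s • b t + (s * (1 - s)) • (t : ℝ) • v ≠
        (1 - s) • a u + s • b u + (s * (1 - s)) • (u : ℝ) • v := fun t u htu heq => by
    have hz : (s, c t, c u) ∈ U := ⟨hs.1, hs.2, htu⟩
    refine hv ⟨(s, c t, c u), ⟨⟨hs, mem_range_self _, mem_range_self _⟩, hz⟩, ?_⟩
    have h0 := hne _ hz
    simp only [Φ, c] at h0 ⊢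
    have h1 : (1 - s) • (a u - a t) + s • (b u - b t) =
        -((s * (1 - s) * ((u : ℝ) - t)) • v) := by
      rw [← sub_eq_zero] at heq ⊢
      rw [← neg_eq_zero, ← heq]
      module
    rw [h1, smul_neg, neg_neg, inv_smul_smul₀ h0]
  intro t u h
  rcases lt_trichotomy t u with htu | htu | htu
  · exact absurd h (main t u htu)
  · exact htu
  · exact absurd h.symm (main u t htu)

/-! ### Homotopies in the space of rectifiable paths -/

namespace RectifiablePath

variable {n : ℕ}

theorem toMap_injective : Function.Injective (toMap (n := n)) := by
  rintro ⟨a, ha⟩ ⟨b, hb⟩ h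
  simpa using h

theorem dist_le_dist_toMap (α β : RectifiablePath n) : dist α β ≤ dist α.toMap β.toMap :=
  frechetDist_le α β ⟨Homeomorph.refl I, rfl⟩

theorem continuous_of_toMap {X : Type*} [TopologicalSpace X] {f : X → RectifiablePath n}
    (hf : Continuous fun x => (f x).toMap) : Continuous f :=
  continuous_iff_continuousAt.2 fun _ => tendsto_iff_dist_tendsto_zero.2 <|
    squeeze_zero (fun _ => dist_nonneg) (fun _ => dist_le_dist_toMap _ _)
      (tendsto_iff_dist_tendsto_zero.1 hf.continuousAt)

/-- The path `β ∘ r`. -/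
def reparam (β : RectifiablePath n) (r : Reparam) : RectifiablePath n where
  toMap := β.toMap.comp (r.1 : C(I, I))
  length_ne_top := by
    have hr : StrictMono r.1 := r.1.continuous.strictMono_of_inj_boundedOrder
      (by rw [show (⊥ : I) = 0 from rfl, r.2]; exact bot_le) r.1.injective
    exact ne_top_of_le_ne_top β.length_ne_top (eVariationOn.comp_le_of_monotoneOn _ _
      (hr.monotone.monotoneOn _) (mapsTo_univ _ _))

theorem dist_reparam (β : RectifiablePath n) (r : Reparam) : dist (β.reparam r) β = 0 :=
  le_antisymm ((frechetDist_le (β.reparam r) β r).trans_eq (dist_self _)) dist_nonneg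

theorem exists_reparam_dist_lt {α β : RectifiablePath n} {δ : ℝ} (h : dist α β < δ) :
    ∃ r : Reparam, dist α.toMap (β.reparam r).toMap < δ := by
  change frechetDist α β < δ at h
  rw [frechetDist_eq] at h
  exact exists_lt_of_ciInf_lt h

/-- The path `t ↦ t v`. -/
def segmentMap (v : EuclideanSpace ℝ (Fin n)) : C(I, EuclideanSpace ℝ (Fin n)) where
  toFun t := (t : ℝ) • v

theorem norm_segmentMap_le (v : EuclideanSpace ℝ (Fin n)) : ‖segmentMap v‖ ≤ ‖v‖ :=
  (ContinuousMap.norm_le _ (norm_nonneg _)).2 fun t => by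
    change ‖(t : ℝ) • v‖ ≤ _
    rw [norm_smul, Real.norm_of_nonneg t.2.1]
    exact mul_le_of_le_one_left (norm_nonneg _) t.2.2

/-- The straight-line homotopy from `α` to `β`, bent by `s (1 - s) t v`. -/
noncomputable def bentHomotopy (α β : RectifiablePath n) (v : EuclideanSpace ℝ (Fin n)) (s : ℝ) :
    RectifiablePath n where
  toMap := (1 - s) • α.toMap + s • β.toMap + (s * (1 - s)) • segmentMap v
  length_ne_top :=
    boundedVariationOn_bentHomotopy α.length_ne_top β.length_ne_top v s

theorem bentHomotopy_zero (α β : RectifiablePath n) (v : EuclideanSpace ℝ (Fin n)) :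
    bentHomotopy α β v 0 = α := by
  refine toMap_injective (ContinuousMap.ext fun t => ?_)
  simp [bentHomotopy]

theorem bentHomotopy_one (α β : RectifiablePath n) (v : EuclideanSpace ℝ (Fin n)) :
    bentHomotopy α β v 1 = β := by
  refine toMap_injective (ContinuousMap.ext fun t => ?_)
  simp [bentHomotopy]

theorem continuous_bentHomotopy (α β : RectifiablePath n) (v : EuclideanSpace ℝ (Fin n)) :
    Continuous (bentHomotopy α β v) :=
  continuous_of_toMap (by unfold bentHomotopy; fun_prop)

theorem dist_bentHomotopy_le (α β : RectifiablePath n) (v : EuclideanSpace ℝ (Fin n)) {s : ℝ}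
    (hs : s ∈ Icc (0 : ℝ) 1) :
    dist (bentHomotopy α β v s) α ≤ dist α.toMap β.toMap + ‖v‖ := by
  refine (dist_le_dist_toMap _ _).trans ?_
  have h : (bentHomotopy α β v s).toMap - α.toMap =
      s • (β.toMap - α.toMap) + (s * (1 - s)) • segmentMap v := by
    simp only [bentHomotopy]
    module
  have h1 : 0 ≤ 1 - s := sub_nonneg.2 hs.2
  rw [dist_eq_norm, h, dist_comm, dist_eq_norm]
  refine (norm_add_le _ _).trans (add_le_add ?_ ?_)
  · rw [norm_smul, Real.norm_of_nonneg hs.1]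
    exact mul_le_of_le_one_left (norm_nonneg _) hs.2
  · rw [norm_smul, Real.norm_of_nonneg (mul_nonneg hs.1 h1)]
    refine (mul_le_of_le_one_left (norm_nonneg _) ?_).trans (norm_segmentMap_le v)
    exact mul_le_one₀ hs.2 h1 (by linarith [hs.1])

theorem isEmbedding_toMap_iff (α : RectifiablePath n) :
    IsEmbedding α.toMap ↔ Function.Injective α.toMap :=
  ⟨fun h => h.injective, fun h => (α.toMap.continuous.isClosedEmbedding h).isEmbedding⟩

/-- Embedded paths at uniform distance less than `δ` are joined by a family of embedded paths
that stays within distance `δ` of the first one. -/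
theorem exists_bentHomotopy_injective (hn : 4 ≤ n) {α β : RectifiablePath n}
    (hα : IsEmbedding α.toMap) (hβ : IsEmbedding β.toMap) {δ : ℝ}
    (h : dist α.toMap β.toMap < δ) :
    ∃ v, ∀ s ∈ Icc (0 : ℝ) 1, IsEmbedding (bentHomotopy α β v s).toMap ∧
      dist (bentHomotopy α β v s) α < δ := by
  -- The bend moves points by at most `‖v‖`, so `v` is chosen within the slack left by the strict
  -- inequality.
  obtain ⟨v, hvball, hv⟩ := (dense_injective_bent_homotopy
    (E := EuclideanSpace ℝ (Fin n)) (by simpa using hn) α.length_ne_top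
    β.length_ne_top).inter_open_nonempty (ball 0 (δ - dist α.toMap β.toMap)) isOpen_ball
    ⟨0, mem_ball_self (sub_pos.2 h)⟩
  refine ⟨v, fun s hs => ⟨?_, ?_⟩⟩
  -- At the end times the bend vanishes and says nothing about injectivity; there the curves are `α`
  -- and `β`.
  · rcases hs.1.eq_or_lt with rfl | h0
    · rwa [bentHomotopy_zero]
    rcases hs.2.eq_or_lt with rfl | h1
    · rwa [bentHomotopy_one]
    exact (isEmbedding_toMap_iff _).2 (hv s ⟨h0, h1⟩)
  · have := dist_bentHomotopy_le α β v hs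
    rw [mem_ball_zero_iff] at hvball
    linarith

end RectifiablePath

open RectifiablePath in
theorem mainTheorem10 (n : ℕ) (hn : 4 ≤ n) (x : EmbeddedPathSpace n) (δ : ℝ) (hδ : 0 < δ) :
    IsPathConnected (Metric.ball x δ) := by
  refine ⟨x, mem_ball_self hδ, fun {y} hy => ?_⟩
  obtain ⟨_, α, hα, rfl⟩ := x
  obtain ⟨_, β, hβ, rfl⟩ := y
  have hd : dist α β < δ := by
    rw [dist_comm]
    exact hy
  obtain ⟨r, hr⟩ := exists_reparam_dist_lt hd
  obtain ⟨v, hv⟩ := exists_bentHomotopy_injective hn hα (β := β.reparam r)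
    (hβ.comp r.1.isEmbedding) hr
  refine ⟨⟨⟨fun s => ⟨SeparationQuotient.mk (bentHomotopy α (β.reparam r) v s),
    _, (hv s s.2).1, rfl⟩, ?_⟩, ?_, ?_⟩, fun s => (hv s s.2).2⟩
  · exact (SeparationQuotient.continuous_mk.comp
      ((continuous_bentHomotopy _ _ _).comp continuous_subtype_val)).subtype_mk _
  · exact Subtype.ext (by simp [bentHomotopy_zero])
  · refine Subtype.ext ?_
    simp only [Icc.coe_one, bentHomotopy_one]
    exact SeparationQuotient.mk_eq_mk.2 (Metric.inseparable_iff.2 (dist_reparam β r))
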